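/- Fix $\alpha\in(0,1)$. Let $X\in\mathbb{R}^{n\times p}$ be a fixed design matrix in the classical case $\operatorname{rank}(X)=p\ge 1$, and let $Y\sim\mathcal N_n(\mu,\sigma^2 I)$ with arbitrary $\mu\in\mathbb{R}^n$ and known $\sigma>0$. Let $\mathcal M_{\mathrm{all}}$ be the set of all nonempty $M\subseteq\{1,\dots,p\}$ for which the submatrix $X_M$ of the columns of $X$ with index in $M$ has rank $|M|$. For $j\in M\in\mathcal M_{\mathrm{all}}$ let $\hat\beta_{j\cdot M}$ and $\beta_{j\cdot M}$ be the entries with index $j$ of $(X_M^TX_M)^{-1}X_M^TY$ and $(X_M^TX_M)^{-1}X_M^T\mu$, and put $$t_{j\cdot M}=\frac{\hat\beta_{j\cdot M}-\beta_{j\cdot M}}{\bigl((X_M^TX_M)^{-1}\bigr)_{jj}^{1/2}\,\sigma}.$$ The PoSI constant $K(X,\mathcal M_{\mathrm{all}},\alpha)$ (for known $\sigma$) is the minimal real number $K$ with $$\mathbb P\Bigl[\max_{M\in\mathcal M_{\mathrm{all}}}\max_{j\in M}|t_{j\cdot M}|\le K\Bigr]\ge 1-\alpha .$$ Then this minimum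 exists, and $$\limsup_{p\to\infty}\ \sup_{X}\ \frac{K(X,\mathcal M_{\mathrm{all}},\alpha)}{\sqrt p}\ \le\ \frac{\sqrt3}{2},$$ where the supremum is over all $n$ and all $X\in\mathbb{R}^{n\times p}$ with $\operatorname{rank}(X)=p$ (and over all $\mu\in\mathbb{R}^n$ and $\sigma>0$). -/

import Mathlib

open MeasureTheory ProbabilityTheory Filter

namespace PoSI

noncomputable section

/-- The matrix `X_M` formed by the columns of `X` with index in `M`. -/
def subDesign {n p : ℕ} (X : Matrix (Fin n) (Fin p) ℝ) (M : Finset (Fin p)) :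
    Matrix (Fin n) M ℝ :=
  X.submatrix id (fun j : M => (j : Fin p))

/-- The universe of all submodels: nonempty sets `M` of predictors for which `X_M` has full
rank `|M|`. -/
def allModels {n p : ℕ} (X : Matrix (Fin n) (Fin p) ℝ) : Set (Finset (Fin p)) :=
  {M | M.Nonempty ∧ (subDesign X M).rank = M.card}

/-- The least squares coefficients `(X_Mᵀ X_M)⁻¹ X_Mᵀ y` in the submodel `M`. At `y = μ = E[Y]`
this is the target `β_M = E[β̂_M]`. -/
def lsCoef {n p : ℕ} (X : Matrix (Fin n) (Fin p) ℝ) (M : Finset (Fin p))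
    (y : EuclideanSpace ℝ (Fin n)) : M → ℝ :=
  ((subDesign X M).transpose * subDesign X M)⁻¹.mulVec
    ((subDesign X M).transpose.mulVec (fun i => y i))

/-- The `t`-ratio `t_{j·M}` of the estimate `β̂_{j·M}` about its target `β_{j·M}`, with known
error standard deviation `σ`. -/
def tStat {n p : ℕ} (X : Matrix (Fin n) (Fin p) ℝ) (M : Finset (Fin p)) (j : M)
    (μ : EuclideanSpace ℝ (Fin n)) (σ : ℝ) (y : EuclideanSpace ℝ (Fin n)) : ℝ :=
  (lsCoef X M y j - lsCoef X M μ j) /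
    (Real.sqrt (((subDesign X M).transpose * subDesign X M)⁻¹ j j) * σ)

/-- The law `N(μ, σ² I)` of the response. -/
def responseLaw {n : ℕ} (μ : EuclideanSpace ℝ (Fin n)) (σ : ℝ) :
    Measure (EuclideanSpace ℝ (Fin n)) :=
  multivariateGaussian μ (σ ^ 2 • (1 : Matrix (Fin n) (Fin n) ℝ))

/-- The numbers `K` such that `max_{M ∈ 𝓜} max_{j ∈ M} |t_{j·M}| ≤ K` has probability at least
`1 - α` under `Y ∼ N(μ, σ² I)`. -/
def coveringConstants {n p : ℕ} (X : Matrix (Fin n) (Fin p) ℝ) (𝓜 : Set (Finset (Fin p)))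
    (α : ℝ) (μ : EuclideanSpace ℝ (Fin n)) (σ : ℝ) : Set ℝ :=
  {K | 1 - α ≤ (responseLaw μ σ).real
    {y | ∀ M ∈ 𝓜, ∀ j : M, |tStat X M j μ σ y| ≤ K}}

/-- The PoSI constant `K(X, 𝓜, α)` for known error variance: the minimal covering constant. -/
def posiConstant {n p : ℕ} (X : Matrix (Fin n) (Fin p) ℝ) (𝓜 : Set (Finset (Fin p)))
    (α : ℝ) (μ : EuclideanSpace ℝ (Fin n)) (σ : ℝ) : ℝ :=
  sInf (coveringConstants X 𝓜 α μ σ)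

end

end PoSI

namespace PoSI

/-! Each t-ratio is the inner product of the standardised error `z` with a unit vector of the column
space (`tStat_add_smul`). The vectors depend on `X` alone, so bounds are uniform in `μ` and `σ`, and
projecting `z` replaces the dimension `n` by `p`.

At most `p * 2 ^ p` unit vectors occur, and only their number is used. With `‖z‖ ^ 2` close to `p`,
the event `⟪l, z⟫ ^ 2 > (3 / 4 + ε) p` is a pair of spherical caps. At squared cosine `3 / 4` the
sine is `1 / 2`, so their probability is about `2⁻¹ ^ p`. The excess `ε` adds an exponentially small
factor (`stdGaussian_real_inner_sq_gt_le`), so the union bound tends to `0`. Existence of the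
minimum is right continuity of a distribution function. -/

/-! ### Exponential moments of Gaussian quadratic forms -/

lemma integrable_exp_mul_sq_gaussianReal {c : ℝ} (hc : c < 1 / 2) :
    Integrable (fun x : ℝ => Real.exp (c * x ^ 2)) (gaussianReal 0 1) := by
  rw [gaussianReal_of_var_ne_zero _ one_ne_zero,
    integrable_withDensity_iff (measurable_gaussianPDF 0 1)
      (ae_of_all _ fun _ => gaussianPDF_lt_top)]
  have h := (integrable_exp_neg_mul_sq (show 0 < 1 / 2 - c by linarith)).mul_const
    (√(2 * Real.pi))⁻¹
  refine h.congr (ae_of_all _ fun x => ?_)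
  simp only [toReal_gaussianPDF, gaussianPDFReal, sub_zero, NNReal.coe_one, mul_one]
  rw [mul_left_comm, ← Real.exp_add, mul_comm]
  ring_nf

lemma integral_exp_mul_sq_gaussianReal {c : ℝ} (hc : c < 1 / 2) :
    ∫ x, Real.exp (c * x ^ 2) ∂(gaussianReal 0 1) = (√(1 - 2 * c))⁻¹ := by
  rw [integral_gaussianReal_eq_integral_smul one_ne_zero]
  have h : ∀ x : ℝ, gaussianPDFReal 0 1 x • Real.exp (c * x ^ 2) =
      (√(2 * Real.pi))⁻¹ * Real.exp (-(1 / 2 - c) * x ^ 2) := fun x => by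
    simp only [gaussianPDFReal, sub_zero, NNReal.coe_one, mul_one, smul_eq_mul]
    rw [mul_assoc, ← Real.exp_add]
    ring_nf
  simp_rw [h]
  have hc' : 0 < 1 - 2 * c := by linarith
  rw [integral_const_mul, integral_gaussian, ← Real.sqrt_inv, ← Real.sqrt_inv,
    ← Real.sqrt_mul (by positivity)]
  congr 1
  have : 1 / 2 - c ≠ 0 := by linarith
  have := Real.pi_ne_zero
  rw [show 1 - 2 * c = 2 * (1 / 2 - c) by ring]
  field_simp

variable {V : Type*} [NormedAddCommGroup V] [InnerProductSpace ℝ V] [FiniteDimensional ℝ V]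

lemma exists_orthonormalBasis_apply_eq {p : ℕ} (hV : Module.finrank ℝ V = p + 1) {l : V}
    (hl : ‖l‖ = 1) : ∃ b : OrthonormalBasis (Fin (p + 1)) ℝ V, b 0 = l := by
  obtain ⟨b, hb⟩ := Orthonormal.exists_orthonormalBasis_extension_of_card_eq (𝕜 := ℝ)
    (ι := Fin (p + 1)) (by simpa using hV) (v := fun _ => l) (s := {0})
    (by simp [hl])
  exact ⟨b, hb 0 rfl⟩

variable [MeasurableSpace V] [BorelSpace V]

/-- In an orthonormal basis starting with `l` the integrand factorises: one coordinate has
coefficient `a + b`, the other `p` have `b`. -/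
lemma integrable_and_integral_exp_quadratic_stdGaussian {p : ℕ}
    (hV : Module.finrank ℝ V = p + 1) {l : V} (hl : ‖l‖ = 1) {a b : ℝ} (hb : b < 1 / 2)
    (hab : a + b < 1 / 2) :
    Integrable (fun z => Real.exp (a * inner ℝ l z ^ 2 + b * ‖z‖ ^ 2)) (stdGaussian V) ∧
    ∫ z, Real.exp (a * inner ℝ l z ^ 2 + b * ‖z‖ ^ 2) ∂(stdGaussian V) =
      (√(1 - 2 * (a + b)))⁻¹ * ((√(1 - 2 * b))⁻¹) ^ p := by
  obtain ⟨e, he⟩ := exists_orthonormalBasis_apply_eq hV hl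
  let f : Fin (p + 1) → ℝ → ℝ := fun i x => Real.exp ((if i = 0 then a + b else b) * x ^ 2)
  have hf : ∀ x : Fin (p + 1) → ℝ,
      Real.exp (a * inner ℝ l (∑ i, x i • e i) ^ 2 + b * ‖∑ i, x i • e i‖ ^ 2) =
        ∏ i, f i (x i) := fun x => by
    have h1 : inner ℝ l (∑ i, x i • e i) = x 0 := by
      rw [← he, e.orthonormal.inner_right_fintype]
    have h2 : ‖∑ i, x i • e i‖ ^ 2 = ∑ i, x i ^ 2 := by
      rw [← e.sum_sq_norm_inner_right]
      simp [e.orthonormal.inner_right_fintype]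
    rw [h1, h2, Fin.prod_univ_succ, Fin.sum_univ_succ]
    simp only [f, Fin.succ_ne_zero, if_true, if_false]
    rw [← Real.exp_sum, ← Real.exp_add, ← Finset.mul_sum]
    ring_nf
  have hm : Measurable (fun x : Fin (p + 1) → ℝ => ∑ i, x i • e i) := by fun_prop
  have hc : AEStronglyMeasurable (fun z => Real.exp (a * inner ℝ l z ^ 2 + b * ‖z‖ ^ 2))
      ((Measure.pi fun _ : Fin (p + 1) => gaussianReal 0 1).map (fun x => ∑ i, x i • e i)) :=
    (by fun_prop : Continuous _).aestronglyMeasurable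
  rw [stdGaussian_eq_map_pi_orthonormalBasis e]
  constructor
  · rw [integrable_map_measure hc hm.aemeasurable]
    simp only [Function.comp_def, hf]
    refine Integrable.fintype_prod fun i => integrable_exp_mul_sq_gaussianReal ?_
    split_ifs <;> assumption
  · rw [integral_map hm.aemeasurable hc]
    simp only [hf]
    rw [integral_fintype_prod_eq_prod, Fin.prod_univ_succ]
    simp only [f, Fin.succ_ne_zero, if_true, if_false]
    rw [integral_exp_mul_sq_gaussianReal hab, integral_exp_mul_sq_gaussianReal hb]
    simp

/-- The Chernoff bound for a quadratic form of a standard Gaussian vector. -/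
lemma stdGaussian_real_quadratic_ge_le {p : ℕ}
    (hV : Module.finrank ℝ V = p + 1) {l : V} (hl : ‖l‖ = 1) {a b : ℝ} (hb : b < 1 / 2)
    (hab : a + b < 1 / 2) (t : ℝ) :
    (stdGaussian V).real {z | t ≤ a * inner ℝ l z ^ 2 + b * ‖z‖ ^ 2} ≤
      Real.exp (-t) * ((√(1 - 2 * (a + b)))⁻¹ * ((√(1 - 2 * b))⁻¹) ^ p) := by
  obtain ⟨hi, he⟩ := integrable_and_integral_exp_quadratic_stdGaussian hV hl hb hab
  have h := mul_meas_ge_le_integral_of_nonneg (ae_of_all _ fun z => (Real.exp_pos _).le) hi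
    (Real.exp t)
  simp only [Real.exp_le_exp] at h
  rw [he] at h
  rw [Real.exp_neg, inv_mul_eq_div, le_div_iff₀ (Real.exp_pos t), mul_comm]
  exact h

/-! ### Tail bounds in dimension `p + 1` -/

lemma stdGaussian_real_inner_sq_gt_le {p : ℕ} (hV : Module.finrank ℝ V = p + 1) {l : V}
    (hl : ‖l‖ = 1) {ε : ℝ} (hε : 0 < ε) :
    (stdGaussian V).real {z | (3 / 4 + ε) * (p + 1) < inner ℝ l z ^ 2 ∧
        ‖z‖ ^ 2 ≤ (1 + ε / 3) * (p + 1)} ≤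
      (√(2 * (ε / (3 / 4 + ε))))⁻¹ * (Real.exp (-(ε / 2)) ^ (p + 1) * 2⁻¹ ^ p) := by
  set η := ε / (3 / 4 + ε) with hη
  have hη0 : 0 < η := by positivity
  have hη1 : η < 1 := by rw [hη, div_lt_one (by positivity)]; linarith
  have hηε : η * (3 / 4 + ε) = ε := by rw [hη]; field_simp
  -- `b = -3/2` makes `√(1 - 2b) = 2`, which gives `2⁻¹ ^ p`; `η` keeps `a + b` below `1/2`. On the
  -- event the form exceeds `(3/2 + 2ε - ε) - (3/2 + ε/2) = ε/2` per dimension.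
  have h := stdGaussian_real_quadratic_ge_le hV hl (a := 2 - η) (b := -(3 / 2)) (by norm_num)
    (by linarith) (ε / 2 * (p + 1))
  have h4 : √(1 - 2 * (-(3 / 2)) : ℝ) = 2 := by
    rw [show (1 - 2 * (-(3 / 2)) : ℝ) = 2 ^ 2 by norm_num, Real.sqrt_sq (by norm_num)]
  rw [h4, show 1 - 2 * (2 - η + -(3 / 2)) = 2 * η by ring] at h
  refine (measureReal_mono ?_).trans (h.trans_eq ?_)
  · rintro z ⟨h1, h2⟩
    simp only [Set.mem_ofPred_eq]
    clear_value η
    have := mul_le_mul_of_nonneg_left h1.le (show 0 ≤ 2 - η by linarith)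
    linear_combination this + 3 / 2 * h2 + (p + 1) * hηε
  · rw [← Real.exp_nat_mul]
    push_cast
    ring_nf

lemma exists_stdGaussian_real_norm_sq_gt_le {δ : ℝ} (hδ : 0 < δ) :
    ∃ q : ℝ, 0 ≤ q ∧ q < 1 ∧ ∀ {V : Type} [NormedAddCommGroup V] [InnerProductSpace ℝ V]
      [FiniteDimensional ℝ V] [MeasurableSpace V] [BorelSpace V] {p : ℕ},
      Module.finrank ℝ V = p + 1 →
      (stdGaussian V).real {z | (1 + δ) * (p + 1) < ‖z‖ ^ 2} ≤ q ^ (p + 1) := by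
  set u := δ / (2 * (1 + δ)) with hu
  have hu0 : 0 < u := by positivity
  have hu1 : u * (1 + δ) = δ / 2 := by rw [hu]; field_simp
  have hu2 : u < 1 / 2 := by
    rw [hu, div_lt_div_iff₀ (by positivity) (by norm_num)]; linarith
  refine ⟨Real.exp (-(u / 2 * (1 + δ))) * (√(1 - u))⁻¹, by positivity, ?_, ?_⟩
  · rw [mul_inv_lt_iff₀ (Real.sqrt_pos.2 (by linarith)), one_mul]
    refine Real.lt_sqrt_of_sq_lt ?_
    rw [← Real.exp_nat_mul]
    have h1 : ((2 : ℕ) : ℝ) * -(u / 2 * (1 + δ)) = -(δ / 2) := by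
      push_cast; linear_combination -hu1
    rw [h1, Real.exp_neg, inv_lt_iff_one_lt_mul₀ (Real.exp_pos _)]
    have h2 : δ / 2 + 1 ≤ Real.exp (δ / 2) := Real.add_one_le_exp _
    have h3 : (1 - u) * (δ / 2 + 1) ≤ (1 - u) * Real.exp (δ / 2) :=
      mul_le_mul_of_nonneg_left h2 (by linarith)
    -- `(1 - u)(1 + δ/2) = 1 + δ² / (4(1 + δ))`.
    refine lt_of_lt_of_le ?_ h3
    nlinarith
  · intro V _ _ _ _ _ p hV
    have : Nontrivial V := Module.nontrivial_of_finrank_pos (R := ℝ) (by omega)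
    obtain ⟨l, hl⟩ := exists_norm_eq V zero_le_one
    have h := stdGaussian_real_quadratic_ge_le hV hl (a := 0) (b := u / 2) (by linarith)
      (by linarith) (u / 2 * ((1 + δ) * (p + 1)))
    refine (measureReal_mono ?_).trans (h.trans_eq ?_)
    · intro z hz
      simp only [Set.mem_ofPred_eq] at hz ⊢
      have := mul_le_mul_of_nonneg_left hz.le (show 0 ≤ u / 2 by positivity)
      linarith
    · rw [mul_pow, ← Real.exp_nat_mul, zero_add, ← pow_succ']
      push_cast
      ring_nf

/-- A union bound for the maximum of `|⟪l i, z⟫|` over unit vectors `l i`. -/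
lemma exists_stdGaussian_real_exists_inner_gt_le {c : ℝ} (hc : √3 / 2 < c) :
    ∃ q r C : ℝ, 0 ≤ q ∧ q < 1 ∧ 0 ≤ r ∧ r < 1 ∧ 0 ≤ C ∧
      ∀ {V : Type} [NormedAddCommGroup V] [InnerProductSpace ℝ V]
      [FiniteDimensional ℝ V] [MeasurableSpace V] [BorelSpace V] {p : ℕ} {ι : Type} (F : Finset ι)
      (l : ι → V), Module.finrank ℝ V = p + 1 → (∀ i ∈ F, ‖l i‖ = 1) →
      (stdGaussian V).real {z | ∃ i ∈ F, c * √(p + 1) < |inner ℝ (l i) z|} ≤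
        q ^ (p + 1) + F.card * (C * (r ^ (p + 1) * 2⁻¹ ^ p)) := by
  have hc0 : 0 < c := lt_of_le_of_lt (by positivity) hc
  have hc2 : 3 / 4 < c ^ 2 := by
    have := pow_lt_pow_left₀ hc (by positivity) two_ne_zero
    rw [div_pow, Real.sq_sqrt (by norm_num)] at this
    linarith
  obtain ⟨ε, hε⟩ : ∃ ε, ε = c ^ 2 - 3 / 4 := ⟨_, rfl⟩
  have hε0 : 0 < ε := by linarith
  obtain ⟨q, hq0, hq1, hq⟩ := exists_stdGaussian_real_norm_sq_gt_le (δ := ε / 3) (by positivity)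
  refine ⟨q, Real.exp (-(ε / 2)), (√(2 * (ε / (3 / 4 + ε))))⁻¹, hq0, hq1, (Real.exp_pos _).le,
    by rw [Real.exp_lt_one_iff]; linarith, by positivity, ?_⟩
  intro V _ _ _ _ _ p ι F l hV hl
  have hsub : {z : V | ∃ i ∈ F, c * √(p + 1) < |inner ℝ (l i) z|} ⊆
      {z | (1 + ε / 3) * (p + 1) < ‖z‖ ^ 2} ∪ ⋃ i ∈ F,
        {z | (3 / 4 + ε) * (p + 1) < inner ℝ (l i) z ^ 2 ∧ ‖z‖ ^ 2 ≤ (1 + ε / 3) * (p + 1)} := by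
    rintro z ⟨i, hi, hz⟩
    by_cases h : (1 + ε / 3) * (p + 1) < ‖z‖ ^ 2
    · exact Or.inl h
    · refine Or.inr (Set.mem_biUnion hi ⟨?_, not_lt.1 h⟩)
      have := pow_lt_pow_left₀ hz (by positivity) two_ne_zero
      rw [mul_pow, Real.sq_sqrt (by positivity), sq_abs] at this
      rw [hε]
      linarith
  refine (measureReal_mono hsub).trans ((measureReal_union_le _ _).trans ?_)
  refine add_le_add (hq hV) ((measureReal_biUnion_finset_le _ _).trans ?_)
  rw [← nsmul_eq_mul]
  exact Finset.sum_le_card_nsmul _ _ _ fun i hi =>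
    stdGaussian_real_inner_sq_gt_le hV (hl i hi) hε0

/-- The orthogonal projection of a standard Gaussian vector is a standard Gaussian vector. -/
lemma stdGaussian_map_orthogonalProjection (S : Submodule ℝ V) :
    (stdGaussian V).map S.orthogonalProjectionOnto = stdGaussian S := by
  refine Measure.ext_of_charFun (funext fun t => ?_)
  -- The adjoint of the projection is the inclusion, which preserves the norm.
  have h : charFun ((stdGaussian V).map S.orthogonalProjectionOnto) t =
      charFun (stdGaussian V) (t : V) := by
    rw [charFun_apply, charFun_apply, integral_map (by fun_prop) (by fun_prop)]
    simp
  rw [h, charFun_stdGaussian, charFun_stdGaussian]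
  simp

lemma stdGaussian_real_exists_inner_gt_eq (S : Submodule ℝ V) {ι : Type*} (F : Finset ι)
    (l : ι → S) (K : ℝ) :
    (stdGaussian V).real {z | ∃ i ∈ F, K < |inner ℝ (l i : V) z|} =
      (stdGaussian S).real {z | ∃ i ∈ F, K < |inner ℝ (l i) z|} := by
  have hm : MeasurableSet {z : S | ∃ i ∈ F, K < |inner ℝ (l i) z|} := by
    have : {z : S | ∃ i ∈ F, K < |inner ℝ (l i) z|} =
        ⋃ i ∈ F, {z : S | K < |inner ℝ (l i) z|} := by ext; simp
    rw [this]
    exact Finset.measurableSet_biUnion _ fun i _ =>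
      (isOpen_lt continuous_const (by fun_prop)).measurableSet
  rw [← stdGaussian_map_orthogonalProjection S, map_measureReal_apply (by fun_prop) hm]
  simp [← Submodule.inner_starProjection_left_eq_right]


lemma responseLaw_eq_map {n : ℕ} (μ : EuclideanSpace ℝ (Fin n)) {σ : ℝ} (hσ : 0 < σ) :
    responseLaw μ σ = (stdGaussian (EuclideanSpace ℝ (Fin n))).map (fun z => μ + σ • z) := by
  open scoped MatrixOrder in
  have h : CFC.sqrt (σ ^ 2 • (1 : Matrix (Fin n) (Fin n) ℝ)) = σ • 1 := by
    refine CFC.sqrt_unique ?_ ?_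
    · rw [smul_mul_smul_comm, one_mul, sq]
    · exact (Matrix.PosSemidef.one.smul hσ.le).nonneg
  rw [responseLaw, multivariateGaussian, h]
  simp

/-! ### The t-ratios as inner products with unit vectors -/

/-- The column space of `X` in `EuclideanSpace`. -/
noncomputable def columnSpace {n p : ℕ} (X : Matrix (Fin n) (Fin p) ℝ) :
    Submodule ℝ (EuclideanSpace ℝ (Fin n)) :=
  (LinearMap.range X.mulVecLin).map
    ((WithLp.linearEquiv 2 ℝ (Fin n → ℝ)).symm : (Fin n → ℝ) →ₗ[ℝ] EuclideanSpace ℝ (Fin n))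

lemma finrank_columnSpace {n p : ℕ} (X : Matrix (Fin n) (Fin p) ℝ) :
    Module.finrank ℝ (columnSpace X) = X.rank :=
  LinearEquiv.finrank_map_eq _ _

lemma toLp_subDesign_mulVec_mem_columnSpace {n p : ℕ} (X : Matrix (Fin n) (Fin p) ℝ)
    (M : Finset (Fin p)) (u : M → ℝ) :
    WithLp.toLp 2 ((subDesign X M).mulVec u) ∈ columnSpace X := by
  refine Submodule.mem_map.2 ⟨_, ⟨fun k => if h : k ∈ M then u ⟨k, h⟩ else 0, rfl⟩, ?_⟩
  change WithLp.toLp 2 _ = WithLp.toLp 2 _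
  congr 1
  ext i
  simp only [Matrix.mulVecLin_apply, Matrix.mulVec, dotProduct, subDesign, Matrix.submatrix_apply,
    id]
  rw [← Finset.sum_subset M.subset_univ (by simp +contextual), ← Finset.sum_coe_sort M]
  simp

/-- The unnormalised direction whose inner product with the response is `β̂_{j·M}`. -/
noncomputable def coefVector {n p : ℕ} (X : Matrix (Fin n) (Fin p) ℝ) (M : Finset (Fin p))
    (j : M) : EuclideanSpace ℝ (Fin n) :=
  WithLp.toLp 2 ((subDesign X M).mulVec
    (((subDesign X M).transpose * subDesign X M)⁻¹.mulVec (Pi.single j 1)))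

lemma lsCoef_eq_inner {n p : ℕ} (X : Matrix (Fin n) (Fin p) ℝ) (M : Finset (Fin p)) (j : M)
    (y : EuclideanSpace ℝ (Fin n)) : lsCoef X M y j = inner ℝ (coefVector X M j) y := by
  have hG : (((subDesign X M).transpose * subDesign X M)⁻¹).transpose =
      ((subDesign X M).transpose * subDesign X M)⁻¹ := by
    rw [Matrix.transpose_nonsing_inv, Matrix.transpose_mul, Matrix.transpose_transpose]
  rw [EuclideanSpace.inner_eq_star_dotProduct]
  simp only [coefVector, star_trivial]
  rw [Matrix.dotProduct_mulVec, Matrix.dotProduct_mulVec, ← Matrix.mulVec_transpose,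
    ← Matrix.mulVec_transpose, hG, dotProduct_single_one]
  rfl

lemma isUnit_gram {n p : ℕ} (X : Matrix (Fin n) (Fin p) ℝ) {M : Finset (Fin p)}
    (hM : (subDesign X M).rank = M.card) :
    IsUnit ((subDesign X M).transpose * subDesign X M) := by
  rw [← Matrix.mulVec_surjective_iff_isUnit, ← Matrix.coe_mulVecLin, ← LinearMap.range_eq_top]
  refine Submodule.eq_top_of_finrank_eq ?_
  rw [Module.finrank_fintype_fun_eq_card, Fintype.card_coe, ← hM]
  exact Matrix.rank_transpose_mul_self _

lemma transpose_mulVec_coefVector {n p : ℕ} (X : Matrix (Fin n) (Fin p) ℝ) {M : Finset (Fin p)}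
    (hM : (subDesign X M).rank = M.card) (j : M) :
    (subDesign X M).transpose.mulVec (fun i => coefVector X M j i) = Pi.single j 1 := by
  have hd := (Matrix.isUnit_iff_isUnit_det _).1 (isUnit_gram X hM)
  change (subDesign X M).transpose.mulVec ((subDesign X M).mulVec
    (((subDesign X M).transpose * subDesign X M)⁻¹.mulVec (Pi.single j 1))) = _
  rw [Matrix.mulVec_mulVec, Matrix.mulVec_mulVec, Matrix.mul_nonsing_inv _ hd, Matrix.one_mulVec]

/-- The squared norm is the least squares coefficient of the vector itself, and `X_Mᵀ` sends that
vector to the unit vector at `j`. -/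
lemma norm_coefVector_sq {n p : ℕ} (X : Matrix (Fin n) (Fin p) ℝ) {M : Finset (Fin p)}
    (hM : (subDesign X M).rank = M.card) (j : M) :
    ‖coefVector X M j‖ ^ 2 = ((subDesign X M).transpose * subDesign X M)⁻¹ j j := by
  rw [← real_inner_self_eq_norm_sq, ← lsCoef_eq_inner, lsCoef, transpose_mulVec_coefVector X hM]
  simp

lemma coefVector_ne_zero {n p : ℕ} (X : Matrix (Fin n) (Fin p) ℝ) {M : Finset (Fin p)}
    (hM : (subDesign X M).rank = M.card) (j : M) : coefVector X M j ≠ 0 := by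
  intro h
  have h1 := congrFun (transpose_mulVec_coefVector X hM j) j
  have h2 : (fun i => coefVector X M j i) = 0 := by rw [h]; rfl
  rw [h2, Matrix.mulVec_zero, Pi.single_eq_same] at h1
  exact zero_ne_one h1

/-- The direction `l` with `t_{j·M} = ⟪l, z⟫` at the standardised error `z = (y - μ) / σ`. -/
noncomputable def tVector {n p : ℕ} (X : Matrix (Fin n) (Fin p) ℝ) (M : Finset (Fin p))
    (j : M) : columnSpace X :=
  ⟨‖coefVector X M j‖⁻¹ • coefVector X M j,
    Submodule.smul_mem _ _ (toLp_subDesign_mulVec_mem_columnSpace X M _)⟩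

lemma norm_tVector {n p : ℕ} (X : Matrix (Fin n) (Fin p) ℝ) {M : Finset (Fin p)}
    (hM : (subDesign X M).rank = M.card) (j : M) : ‖tVector X M j‖ = 1 := by
  change ‖‖coefVector X M j‖⁻¹ • coefVector X M j‖ = 1
  rw [norm_smul, norm_inv, norm_norm,
    inv_mul_cancel₀ (norm_ne_zero_iff.2 (coefVector_ne_zero X hM j))]

lemma tStat_add_smul {n p : ℕ} (X : Matrix (Fin n) (Fin p) ℝ) {M : Finset (Fin p)}
    (hM : (subDesign X M).rank = M.card) (j : M) (μ z : EuclideanSpace ℝ (Fin n)) {σ : ℝ}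
    (hσ : 0 < σ) :
    tStat X M j μ σ (μ + σ • z) = inner ℝ (tVector X M j : EuclideanSpace ℝ (Fin n)) z := by
  rw [tStat, ← norm_coefVector_sq X hM, Real.sqrt_sq (norm_nonneg _), lsCoef_eq_inner,
    lsCoef_eq_inner, inner_add_right, add_sub_cancel_left, tVector, real_inner_smul_left,
    real_inner_smul_right]
  have := norm_ne_zero_iff.2 (coefVector_ne_zero X hM j)
  field_simp

lemma continuous_tStat {n p : ℕ} (X : Matrix (Fin n) (Fin p) ℝ) (M : Finset (Fin p)) (j : M)
    (μ : EuclideanSpace ℝ (Fin n)) (σ : ℝ) : Continuous (tStat X M j μ σ) := by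
  unfold tStat
  simp only [lsCoef_eq_inner]
  fun_prop

lemma univ_mem_allModels {n p : ℕ} (X : Matrix (Fin n) (Fin p) ℝ) (hp : 1 ≤ p)
    (hX : X.rank = p) : Finset.univ ∈ allModels X := by
  refine ⟨⟨⟨0, hp⟩, Finset.mem_univ _⟩, ?_⟩
  have : subDesign X Finset.univ =
      X.submatrix id ((Equiv.subtypeUnivEquiv Finset.mem_univ : _ ≃ Fin p)) := rfl
  rw [this, ← Equiv.coe_refl, Matrix.rank_submatrix, hX, Finset.card_univ, Fintype.card_fin]

/-! ### Existence of the minimum -/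

/-- The values at which a real random variable has a distribution function of at least
`1 - α` have a minimum. -/
lemma isLeast_sInf_le_measureReal_le {Ω : Type*} [MeasurableSpace Ω] (P : Measure Ω)
    [IsProbabilityMeasure P] {α : ℝ} (hα0 : 0 < α) (hα1 : α < 1) {T : Ω → ℝ} (hT : Measurable T) :
    IsLeast {K | 1 - α ≤ P.real {ω | T ω ≤ K}} (sInf {K | 1 - α ≤ P.real {ω | T ω ≤ K}}) := by
  have := Measure.isProbabilityMeasure_map (μ := P) hT.aemeasurable
  have h : ∀ K, P.real {ω | T ω ≤ K} = cdf (P.map T) K := fun K => by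
    rw [cdf_eq_real, map_measureReal_apply hT measurableSet_Iic]
    rfl
  simp only [h]
  set F := cdf (P.map T)
  have hne : {K | 1 - α ≤ F K}.Nonempty :=
    (((tendsto_cdf_atTop (P.map T)).eventually (eventually_ge_nhds (show 1 - α < 1 by linarith))).exists :)
  obtain ⟨B, hB⟩ := ((tendsto_cdf_atBot (P.map T)).eventually
    (eventually_lt_nhds (show 0 < 1 - α by linarith))).exists
  have hbdd : BddBelow {K | 1 - α ≤ F K} := ⟨B, fun K hK => by
    by_contra hlt
    exact absurd (hK.trans (F.mono (not_le.1 hlt).le)) (not_le.2 hB)⟩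
  refine ⟨?_, fun K hK => csInf_le hbdd hK⟩
  -- Every point to the right of the infimum is a covering value by monotonicity; right continuity
  -- passes this to the infimum.
  have hr := F.right_continuous (sInf {K | 1 - α ≤ F K})
  have hr' : Tendsto F (nhdsWithin (sInf {K | 1 - α ≤ F K}) (Set.Ioi _)) _ :=
    hr.tendsto.mono_left (nhdsWithin_mono _ Set.Ioi_subset_Ici_self)
  refine ge_of_tendsto hr' ?_
  filter_upwards [self_mem_nhdsWithin] with K hK
  obtain ⟨K', hK', hlt⟩ := (csInf_lt_iff hbdd hne).1 hK
  exact le_trans hK' (F.mono hlt.le)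

lemma isProbabilityMeasure_responseLaw {n : ℕ} (μ : EuclideanSpace ℝ (Fin n)) (σ : ℝ) :
    IsProbabilityMeasure (responseLaw μ σ) := by
  unfold responseLaw; infer_instance

/-- The pairs of a model and a predictor in it. -/
noncomputable def modelPairs {n p : ℕ} (X : Matrix (Fin n) (Fin p) ℝ) :
    Finset (Σ M : Finset (Fin p), M) :=
  open scoped Classical in Finset.univ.filter fun i => i.1 ∈ allModels X

lemma mem_modelPairs {n p : ℕ} {X : Matrix (Fin n) (Fin p) ℝ} {i : Σ M : Finset (Fin p), M} :
    i ∈ modelPairs X ↔ i.1 ∈ allModels X := by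
  simp [modelPairs]

lemma card_modelPairs_le {n p : ℕ} (X : Matrix (Fin n) (Fin p) ℝ) :
    (modelPairs X).card ≤ p * 2 ^ p := by
  classical
  refine (Finset.card_le_univ _).trans ?_
  rw [Fintype.card_sigma]
  refine (Finset.sum_le_card_nsmul _ _ p fun M _ => ?_).trans_eq ?_
  · simpa using Finset.card_le_univ M
  · simp [mul_comm]

lemma isLeast_posiConstant {n p : ℕ} {α : ℝ} (hα0 : 0 < α) (hα1 : α < 1)
    (X : Matrix (Fin n) (Fin p) ℝ) (μ : EuclideanSpace ℝ (Fin n)) (σ : ℝ) (hp : 1 ≤ p)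
    (hX : X.rank = p) :
    IsLeast (coveringConstants X (allModels X) α μ σ)
      (posiConstant X (allModels X) α μ σ) := by
  have := isProbabilityMeasure_responseLaw μ σ
  have hne : (modelPairs X).Nonempty :=
    ⟨⟨Finset.univ, ⟨⟨0, hp⟩, Finset.mem_univ _⟩⟩, mem_modelPairs.2 (univ_mem_allModels X hp hX)⟩
  let T : EuclideanSpace ℝ (Fin n) → ℝ := fun y =>
    (modelPairs X).sup' hne fun i => |tStat X i.1 i.2 μ σ y|
  have hT : Continuous T :=
    Continuous.finset_sup'_apply hne fun i _ => (continuous_tStat X i.1 i.2 μ σ).abs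
  have hc : coveringConstants X (allModels X) α μ σ =
      {K | 1 - α ≤ (responseLaw μ σ).real {y | T y ≤ K}} := by
    ext K
    simp only [coveringConstants, Set.mem_ofPred_eq, T, Finset.sup'_le_iff, mem_modelPairs,
      Sigma.forall]
    refine Eq.to_iff (congrArg (fun s => 1 - α ≤ (responseLaw μ σ).real s) (Set.ext fun y => ?_))
    exact ⟨fun h M j hM => h M hM j, fun h M hM j => h M j hM⟩
  rw [posiConstant, hc]
  exact isLeast_sInf_le_measureReal_le _ hα0 hα1 hT.measurable

/-! ### The uniform upper bound -/

lemma eventually_posiConstant_le {α : ℝ} (hα0 : 0 < α) (hα1 : α < 1) {c : ℝ}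
    (hc : √3 / 2 < c) :
    ∀ᶠ p : ℕ in atTop, ∀ (n : ℕ) (X : Matrix (Fin n) (Fin p) ℝ), X.rank = p →
      ∀ (μ : EuclideanSpace ℝ (Fin n)) (σ : ℝ), 0 < σ →
        posiConstant X (allModels X) α μ σ ≤ c * √p := by
  obtain ⟨q, r, C, hq0, hq1, hr0, hr1, hC, h⟩ := exists_stdGaussian_real_exists_inner_gt_le hc
  have hlim : Tendsto (fun p : ℕ => q ^ p + 2 * C * (p * r ^ p)) atTop (nhds 0) := by
    simpa using (tendsto_pow_atTop_nhds_zero_of_lt_one hq0 hq1).add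
      ((tendsto_self_mul_const_pow_of_lt_one hr0 hr1).const_mul (2 * C))
  filter_upwards [hlim.eventually (eventually_le_nhds hα0), eventually_ge_atTop 1]
    with p hpα hp n X hX μ σ hσ
  -- By minimality it suffices that `c * √p` is itself a covering constant.
  refine (isLeast_posiConstant hα0 hα1 X μ σ hp hX).2 ?_
  obtain ⟨m, rfl⟩ : ∃ m, p = m + 1 := ⟨p - 1, by omega⟩
  have hdim : Module.finrank ℝ (columnSpace X) = m + 1 := (finrank_columnSpace X).trans hX
  have hbad := h (modelPairs X) (fun i => tVector X i.1 i.2) hdim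
    fun i hi => norm_tVector X (mem_modelPairs.1 hi).2 i.2
  rw [← stdGaussian_real_exists_inner_gt_eq] at hbad
  have hcard : ((modelPairs X).card : ℝ) ≤ (m + 1 : ℕ) * 2 ^ (m + 1) := by
    exact_mod_cast card_modelPairs_le X
  have hbound : q ^ (m + 1) + (modelPairs X).card * (C * (r ^ (m + 1) * 2⁻¹ ^ m)) ≤ α := by
    refine le_trans (add_le_add_right (mul_le_mul_of_nonneg_right hcard (by positivity)) _)
      (le_of_eq_of_le ?_ hpα)
    -- The number of models cancels the cap probability up to a factor `2`, the one in `2 * C`.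
    have : (2 : ℝ) ^ m * 2⁻¹ ^ m = 1 := by rw [← mul_pow]; norm_num
    rw [pow_succ 2 m]
    linear_combination (2 * C * ((m + 1 : ℕ) * r ^ (m + 1))) * this
  have hmeas : MeasurableSet {y | ∀ M ∈ allModels X, ∀ j : M,
      |tStat X M j μ σ y| ≤ c * √((m + 1 : ℕ) : ℝ)} := by
    simp only [Set.ofPred_forall]
    refine IsClosed.measurableSet (isClosed_iInter fun M => isClosed_iInter fun _ =>
      isClosed_iInter fun j => isClosed_le (continuous_tStat X M j μ σ).abs continuous_const)
  have hpre : Measurable fun z : EuclideanSpace ℝ (Fin n) => μ + σ • z := by fun_prop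
  rw [coveringConstants, Set.mem_ofPred_eq, responseLaw_eq_map μ hσ,
    map_measureReal_apply hpre hmeas]
  have hcompl : ((fun z => μ + σ • z) ⁻¹' {y | ∀ M ∈ allModels X, ∀ j : M,
      |tStat X M j μ σ y| ≤ c * √((m + 1 : ℕ) : ℝ)})ᶜ ⊆
      {z | ∃ i ∈ modelPairs X, c * √(m + 1) <
        |inner ℝ (tVector X i.1 i.2 : EuclideanSpace ℝ (Fin n)) z|} := by
    intro z hz
    simp only [Set.mem_compl_iff, Set.mem_preimage, Set.mem_ofPred_eq, not_forall, not_le] at hz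
    obtain ⟨M, hM, j, hlt⟩ := hz
    rw [tStat_add_smul X hM.2 j μ z hσ] at hlt
    exact ⟨⟨M, j⟩, mem_modelPairs.2 hM, by exact_mod_cast hlt⟩
  have h1 := (measureReal_mono hcompl).trans (hbad.trans hbound)
  rw [probReal_compl_eq_one_sub (hpre hmeas)] at h1
  linarith

end PoSI

theorem corollary6p1 (α : ℝ) (hα0 : 0 < α) (hα1 : α < 1) :
    (∀ (p n : ℕ) (X : Matrix (Fin n) (Fin p) ℝ) (μ : EuclideanSpace ℝ (Fin n)) (σ : ℝ),
      1 ≤ p → X.rank = p → 0 < σ →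
        IsLeast (PoSI.coveringConstants X (PoSI.allModels X) α μ σ)
          (PoSI.posiConstant X (PoSI.allModels X) α μ σ)) ∧
    limsup (fun p : ℕ =>
        ⨆ (n : ℕ) (X : Matrix (Fin n) (Fin p) ℝ) (_ : X.rank = p)
          (μ : EuclideanSpace ℝ (Fin n)) (σ : ℝ) (_ : 0 < σ),
          ((PoSI.posiConstant X (PoSI.allModels X) α μ σ / Real.sqrt p : ℝ) : EReal)) atTop
      ≤ ((Real.sqrt 3 / 2 : ℝ) : EReal) := by
  refine ⟨fun p n X μ σ hp hX _ => PoSI.isLeast_posiConstant hα0 hα1 X μ σ hp hX, ?_⟩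
  -- It is enough to bound the limsup by every real `c > √3 / 2`.
  refine EReal.le_of_forall_lt_iff_le.1 fun c hc => ?_
  refine limsup_le_of_le (by isBoundedDefault) ?_
  filter_upwards [PoSI.eventually_posiConstant_le hα0 hα1 (EReal.coe_lt_coe_iff.1 hc),
    eventually_ge_atTop 1] with p h hp
  refine iSup_le fun n => iSup_le fun X => iSup_le fun hX => iSup_le fun μ => iSup_le fun σ =>
    iSup_le fun hσ => EReal.coe_le_coe_iff.2 ?_
  rw [div_le_iff₀ (Real.sqrt_pos.2 (by exact_mod_cast hp))]
  exact h n X hX μ σ hσ
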